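/- Let $V$ be a (commutative) valuation domain. Let $\mathcal C_V^*$ be the class whose objects are the $V$-modules of projective dimension at most $1$. A submodule $A$ of an object $B$ is called tight in $B$ if $B/A$ has projective dimension at most $1$ (then $A$ is an object as well). A morphism of $\mathcal C_V^*$ is a $V$-homomorphism $\phi: M\to N$ between objects whose image is tight in $N$. A $V$-module $E$ is divisible if $rE=E$ for every nonzero $r\in V$. For every object $E$ of $\mathcal C_V^*$ the following conditions are equivalent: (i) $\operatorname{Ext}^1_V(C,E)=0$ for every object $C$ of $\mathcal C_V^*$; (ii) whenever $B$ is an object of $\mathcal C_V^*$ and $A$ is a tight submodule of $B$, every morphism $\phi: A\to E$ of $\mathcal C_V^*$ extends to a $V$-homomorphism $\psi: B\to E$ (not required to be a morphism of $\mathcal C_V^*$); (iii) $E$ is divisible. In other words, the objects $E$ satisfying (i), that is, the injective objects of $\mathcal C_V^*$, are exactly the divisible ones. -/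

import Mathlib

universe u

namespace TightModules

open CategoryTheory

/-- `M` is an object of the class `C_V^*`: a `V`-module of projective dimension at most `1`. -/
def IsObject (V : Type u) [CommRing V] (M : Type u) [AddCommGroup M] [Module V M] : Prop :=
  HasProjectiveDimensionLE (ModuleCat.of V M) 1

/-- The submodule `A` is tight in `B`: both `B` and `B ⧸ A` have projective dimension at
most `1`. -/
structure IsTight {V : Type u} [CommRing V] {B : Type u} [AddCommGroup B] [Module V B]
    (A : Submodule V B) : Prop where
  ambient : IsObject V B
  quotient : IsObject V (B ⧸ A)

/-- The linear map `φ` is a morphism of `C_V^*`: it is a homomorphism between objects whose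
image is tight in the codomain. -/
structure IsMorphism {V : Type u} [CommRing V] {M N : Type u} [AddCommGroup M] [Module V M]
    [AddCommGroup N] [Module V N] (φ : M →ₗ[V] N) : Prop where
  source : IsObject V M
  target : IsObject V N
  range_tight : IsTight (LinearMap.range φ)

/-- `E` is divisible: `r E = E` for every nonzero `r` in `V`. -/
def IsDivisible (V : Type u) [CommRing V] (E : Type u) [AddCommGroup E] [Module V E] : Prop :=
  ∀ r : V, r ≠ 0 → ∀ y : E, ∃ x : E, r • x = y

end TightModules

/-!
A module `C` has projective dimension at most `1` exactly when `C ≃ F ⧸ H` with `F` free and `H`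
projective, and then `Ext¹(C, E) = 0` if and only if every map `H → E` extends to `F`. Applied to
`V ⧸ (r)`, this recovers divisibility from the vanishing of `Ext¹`; the maps `(r) → E`, `r ↦ y`, are
morphisms of the class because cyclic submodules of objects are tight.

Conversely, let `E` be divisible. Over a Bézout domain, adjoining one element `x` to a projective
submodule `N` of a torsion-free module leaves it projective, and the conductor `{r | r • x ∈ N}` is
principal, so a map `N → E` extends to `N ⊔ R ∙ x`, and then to countably many more elements. This
cannot simply be continued transfinitely, since a union of a chain of projective submodules need not
be projective. Zorn's lemma is therefore applied to the partial maps with domain `H ⊔ R^(S)`, where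
`R^(S)` is spanned by a set `S` of coordinates that is saturated, meaning that `H ∩ R^(S)` is a
direct summand of `H` in a way that passes to unions. Then `H ⊔ R^(S)` is projective, and `S` can be
enlarged to a saturated set by countably many coordinates at a time.
-/

namespace TightModules

section ProjectiveSup

variable {R F : Type*} [Ring R] [AddCommGroup F] [Module R F]

theorem projective_ker_of_isIdempotentElem [Module.Projective R F] {θ : Module.End R F}
    (hθ : IsIdempotentElem θ) : Module.Projective R (LinearMap.ker θ) := by
  have hmem (x : F) : (LinearMap.id - θ : F →ₗ[R] F) x ∈ LinearMap.ker θ := by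
    have hx : θ (θ x) = θ x := LinearMap.congr_fun hθ x
    simp [hx]
  exact .of_split (LinearMap.ker θ).subtype (LinearMap.codRestrict _ _ hmem) (by ext; simp)

theorem projective_sup_of_disjoint {K W : Submodule R F} [Module.Projective R K]
    [Module.Projective R W] (h : Disjoint K W) : Module.Projective R (K ⊔ W : Submodule R F) := by
  have hinj : Function.Injective (K.subtype.coprod W.subtype) := by
    rw [← LinearMap.ker_eq_bot, LinearMap.ker_coprod_of_disjoint_range _ _ (by simpa using h)]
    simp
  have hrange : LinearMap.range (K.subtype.coprod W.subtype) = K ⊔ W := by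
    simp [LinearMap.range_coprod]
  exact hrange ▸ .of_equiv (LinearEquiv.ofInjective _ hinj)

theorem projective_sup_of_retraction {H W : Submodule R F} [Module.Projective R H]
    [Module.Projective R W] (θ : H →ₗ[R] H) (hmem : ∀ h, (θ h : F) ∈ W)
    (hfix : ∀ h : H, (h : F) ∈ W → θ h = h) : Module.Projective R (H ⊔ W : Submodule R F) := by
  have := projective_ker_of_isIdempotentElem (θ := θ) (LinearMap.ext fun h => hfix _ (hmem h))
  set K : Submodule R F := (LinearMap.ker θ).map H.subtype
  have : Module.Projective R K :=
    .of_equiv ((LinearMap.ker θ).equivMapOfInjective H.subtype H.injective_subtype)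
  have hdisj : Disjoint K W := by
    rw [Submodule.disjoint_def]
    rintro _ ⟨k, hk, rfl⟩ hkW
    rw [← hfix k hkW, LinearMap.mem_ker.1 hk, map_zero]
  have hsup : K ⊔ W = H ⊔ W := by
    refine le_antisymm (sup_le_sup_right (Submodule.map_subtype_le _ _) _)
      (sup_le (fun x hx => ?_) le_sup_right)
    have hker : (⟨x, hx⟩ : H) - θ ⟨x, hx⟩ ∈ LinearMap.ker θ := by
      rw [LinearMap.mem_ker, map_sub, hfix _ (hmem _), sub_self]
    simpa using Submodule.add_mem_sup (Submodule.mem_map_of_mem (f := H.subtype) hker)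
      (hmem ⟨x, hx⟩)
  exact hsup ▸ projective_sup_of_disjoint hdisj

theorem projective_span_singleton [IsDomain R] [Module.IsTorsionFree R F] (x : F) :
    Module.Projective R (R ∙ x) := by
  rcases eq_or_ne x 0 with rfl | hx
  · rw [Submodule.span_zero_singleton]
    infer_instance
  · exact .of_equiv (LinearEquiv.toSpanNonzeroSingleton R F x hx)

end ProjectiveSup

section Bezout

variable {R : Type*} [CommRing R] [IsDomain R] [IsBezout R]

theorem exists_eq_smul_and_dual_apply_eq_one {P : Type*} [AddCommGroup P] [Module R P]
    [Module.Projective R P] {h : P} (hh : h ≠ 0) :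
    ∃ (d : R) (n : P) (φ : Module.Dual R P), h = d • n ∧ φ n = 1 := by
  obtain ⟨e, he⟩ := Module.projective_def.1 ‹Module.Projective R P›
  have hsum : h = ∑ p ∈ (e h).support, e h p • p := (he h).symm
  obtain ⟨d, hd⟩ := IsBezout.isPrincipal_of_FG (Ideal.span (e h '' (e h).support))
    (Submodule.fg_span ((e h).support.finite_toSet.image _))
  have hdvd (p : P) (hp : p ∈ (e h).support) : d ∣ e h p := by
    rw [← Ideal.mem_span_singleton, ← Ideal.submodule_span_eq, ← hd]
    exact Ideal.subset_span ⟨p, hp, rfl⟩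
  obtain ⟨φ, hφ⟩ : d ∈ LinearMap.range (Module.Dual.eval R P h) := by
    have hle : Ideal.span (e h '' (e h).support) ≤ LinearMap.range (Module.Dual.eval R P h) := by
      rw [Ideal.span_le]
      rintro _ ⟨p, -, rfl⟩
      exact ⟨Finsupp.lapply p ∘ₗ e, rfl⟩
    exact hle (hd ▸ Submodule.mem_span_singleton_self d)
  choose! c hc using hdvd
  set n : P := ∑ p ∈ (e h).support, c p • p
  have hn : h = d • n := by
    rw [Finset.smul_sum]
    refine hsum.trans (Finset.sum_congr rfl fun p hp => ?_)
    rw [hc p hp, mul_smul]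
  have hd0 : d ≠ 0 := by
    rintro rfl
    exact hh (by rw [hn, zero_smul])
  refine ⟨d, n, φ, hn, mul_left_cancel₀ hd0 ?_⟩
  rw [← smul_eq_mul, ← map_smul, ← hn, mul_one]
  exact hφ

variable {F : Type*} [AddCommGroup F] [Module R F] [Module.IsTorsionFree R F]
  {N : Submodule R F} [Module.Projective R N] {x : F}

/-- The element `z` generates both `x` and a basis element `n` of a free direct summand of `N`, so
that adjoining `x` to `N` amounts to enlarging that summand from `R ∙ n` to `R ∙ z`. -/
theorem exists_common_generator_of_smul_mem {r : R} (hrx : r • x ∈ N) (h0 : r • x ≠ 0) :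
    ∃ (a s : R) (z : F) (n : N) (φ : Module.Dual R N),
      IsCoprime a s ∧ a • z = n ∧ s • z = x ∧ φ n = 1 := by
  have h0N : (⟨r • x, hrx⟩ : N) ≠ 0 := fun h => h0 (congrArg Subtype.val h)
  obtain ⟨t, n, φ, hn, hφ⟩ := exists_eq_smul_and_dual_apply_eq_one (R := R) h0N
  have hn : r • x = t • (n : F) := congrArg Subtype.val hn
  have hr : r ≠ 0 := left_ne_zero_of_smul h0
  obtain ⟨u, v, huv⟩ := IsBezout.gcd_eq_sum r t
  obtain ⟨a, ha⟩ := IsBezout.gcd_dvd_left r t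
  obtain ⟨s, hs⟩ := IsBezout.gcd_dvd_right r t
  set d := IsBezout.gcd r t
  have hd : d ≠ 0 := left_ne_zero_of_mul (ha ▸ hr)
  have hcop : u * a + v * s = 1 := mul_left_cancel₀ hd (by linear_combination huv - u * ha - v * hs)
  have hax : a • x = s • (n : F) := smul_right_injective F hd (by
    simpa only [ha, hs, mul_smul] using hn)
  refine ⟨a, s, u • (n : F) + v • x, n, φ, ⟨u, v, hcop⟩, ?_, ?_, hφ⟩
  · calc a • (u • (n : F) + v • x) = (u * a) • (n : F) + v • a • x := by module
      _ = (u * a + v * s) • (n : F) := by rw [hax]; module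
      _ = n := by rw [hcop, one_smul]
  · calc s • (u • (n : F) + v • x) = u • s • (n : F) + (v * s) • x := by module
      _ = (u * a + v * s) • x := by rw [← hax]; module
      _ = x := by rw [hcop, one_smul]

variable (N x)

theorem isPrincipal_colon_singleton : (N.colon {x}).IsPrincipal := by
  by_cases h : ∃ r : R, r • x ∈ N ∧ r • x ≠ 0
  · obtain ⟨r, hrx, h0⟩ := h
    obtain ⟨a, s, z, n, φ, hcop, haz, rfl, hφ⟩ := exists_common_generator_of_smul_mem hrx h0
    refine ⟨a, Ideal.ext fun t => ?_⟩
    rw [Submodule.mem_colon_singleton, Ideal.submodule_span_eq, Ideal.mem_span_singleton]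
    refine ⟨fun ht => hcop.dvd_of_dvd_mul_right ⟨φ ⟨_, ht⟩, ?_⟩, ?_⟩
    · have hsmul : (t * s) • n = a • (⟨t • s • z, ht⟩ : N) := Subtype.ext <| by
        simp only [Submodule.coe_smul, ← haz]
        module
      have hφs : (t * s) * φ n = a * φ ⟨t • s • z, ht⟩ := by
        simpa only [map_smul, smul_eq_mul] using congrArg φ hsmul
      rwa [hφ, mul_one] at hφs
    · rintro ⟨k, rfl⟩
      have hk : (a * k) • s • z = ((k * s) • n : N) := by
        simp only [Submodule.coe_smul, ← haz]
        module
      exact hk ▸ Subtype.coe_prop _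
  · push Not at h
    rcases eq_or_ne x 0 with rfl | hx
    · rw [(Submodule.colon_eq_top_iff_subset _).2 (by simp)]
      exact top_isPrincipal
    · convert bot_isPrincipal
      rw [eq_bot_iff]
      exact fun r hr => (smul_eq_zero.1 (h r (Submodule.mem_colon_singleton.1 hr))).resolve_right hx

theorem projective_sup_span_singleton : Module.Projective R (N ⊔ R ∙ x : Submodule R F) := by
  by_cases h : Disjoint N (R ∙ x)
  · have := projective_span_singleton (R := R) x
    exact projective_sup_of_disjoint h
  obtain ⟨r, hrx, h0⟩ : ∃ r : R, r • x ∈ N ∧ r • x ≠ 0 := by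
    simpa [Submodule.disjoint_def, Submodule.mem_span_singleton, and_comm] using h
  obtain ⟨a, s, z, n, φ, ⟨u, v, hcop⟩, haz, rfl, hφ⟩ := exists_common_generator_of_smul_mem hrx h0
  have hsup : N ⊔ R ∙ (s • z) = N ⊔ R ∙ z := by
    refine le_antisymm (sup_le_sup_left (Submodule.span_singleton_smul_le R s z) N)
      (sup_le le_sup_left ((Submodule.span_singleton_le_iff_mem _ _).2 ?_))
    have hz : u • (n : F) + v • s • z = z := by
      calc u • (n : F) + v • s • z = (u * a + v * s) • z := by rw [← haz]; module
        _ = z := by rw [hcop, one_smul]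
    have hmem := Submodule.add_mem_sup (N.smul_mem u n.2)
      (Submodule.smul_mem (R ∙ (s • z)) v (Submodule.mem_span_singleton_self _))
    rwa [hz] at hmem
  have := projective_span_singleton (R := R) z
  rw [hsup]
  refine projective_sup_of_retraction (φ.smulRight n) (fun m => ?_) fun m hm => ?_
  · rw [LinearMap.smulRight_apply, Submodule.coe_smul, ← haz]
    exact Submodule.smul_mem _ _ (Submodule.smul_mem _ a (Submodule.mem_span_singleton_self z))
  · obtain ⟨t, ht⟩ := Submodule.mem_span_singleton.1 hm
    have htn : t • n = a • m := Subtype.ext <| by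
      simp only [Submodule.coe_smul, ← ht, ← haz, smul_comm a t z]
    have hφm : t = a * φ m := by simpa [hφ] using congrArg φ htn
    refine Subtype.ext ?_
    rw [LinearMap.smulRight_apply, Submodule.coe_smul, ← haz, ← ht, smul_smul, hφm, mul_comm]

end Bezout


section PartialMaps

variable {R F E : Type*} [Ring R] [AddCommGroup F] [Module R F] [AddCommGroup E] [Module R E]

theorem exists_le_domain_eq_sup_span_singleton (p : F →ₗ.[R] E) {x : F} {y : E}
    (h : ∀ (r : R) (hr : r • x ∈ p.domain), p ⟨r • x, hr⟩ = r • y) :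
    ∃ q : F →ₗ.[R] E, p ≤ q ∧ q.domain = p.domain ⊔ R ∙ x := by
  have hker (c : R) (hc : c • x = 0) : c • y = 0 := by
    rw [← h c (hc ▸ p.domain.zero_mem), ← p.map_zero]
    exact congrArg p (Subtype.ext hc)
  let s : F →ₗ.[R] E := LinearPMap.mkSpanSingleton' x y hker
  have hagree (z : p.domain) (w : s.domain) (hzw : (z : F) = w) : p z = s w := by
    obtain ⟨z, hz⟩ := z
    obtain ⟨w, hw⟩ := w
    obtain rfl : z = w := hzw
    obtain ⟨c, rfl⟩ := Submodule.mem_span_singleton.1 hw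
    rw [h c hz, LinearPMap.mkSpanSingleton'_apply, RingHom.id_apply]
  exact ⟨p.sup _ hagree, p.left_le_sup _ hagree, rfl⟩

theorem exists_le_domain_eq_sup_span_range {P : Submodule R F → Prop}
    (hP : ∀ N x, P N → P (N ⊔ R ∙ x))
    (step : ∀ (p : F →ₗ.[R] E) (x : F), P p.domain →
      ∃ q : F →ₗ.[R] E, p ≤ q ∧ q.domain = p.domain ⊔ R ∙ x)
    (p : F →ₗ.[R] E) (hp : P p.domain) (f : ℕ → F) :
    ∃ q : F →ₗ.[R] E, p ≤ q ∧ q.domain = p.domain ⊔ Submodule.span R (Set.range f) := by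
  choose! next hle hdom using step
  let s : ℕ → F →ₗ.[R] E := fun n => n.rec p fun n q => next q (f n)
  have hs (n : ℕ) : P (s n).domain := by
    induction n with
    | zero => exact hp
    | succ n ih => exact (hdom (s n) (f n) ih).symm ▸ hP _ (f n) ih
  have hsucc (n : ℕ) : (s (n + 1)).domain = (s n).domain ⊔ R ∙ f n := hdom _ _ (hs n)
  have hdir : DirectedOn (· ≤ ·) (Set.range s) :=
    directedOn_range.2 (monotone_nat_of_le_succ fun n => hle _ (f n) (hs n)).directed_le
  have hle_sSup (n : ℕ) : s n ≤ LinearPMap.sSup _ hdir := LinearPMap.le_sSup hdir ⟨n, rfl⟩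
  refine ⟨LinearPMap.sSup _ hdir, hle_sSup 0, le_antisymm ?_ (sup_le (hle_sSup 0).1 ?_)⟩
  · rw [LinearPMap.domain_sSup]
    refine sSup_le ?_
    rintro _ ⟨_, ⟨n, rfl⟩, rfl⟩
    induction n with
    | zero => exact le_sup_left
    | succ n ih =>
      rw [hsucc]
      exact sup_le ih (le_sup_of_le_right (Submodule.span_mono (by simp)))
  · rw [Submodule.span_le]
    rintro _ ⟨n, rfl⟩
    exact (hle_sSup (n + 1)).1
      (hsucc n ▸ Submodule.mem_sup_right (Submodule.mem_span_singleton_self _))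

end PartialMaps

section DivisibleExtension

variable {R E : Type u} {F : Type*} [CommRing R] [AddCommGroup F] [Module R F]
  [AddCommGroup E] [Module R E]

theorem IsDivisible.exists_extend_sup_span_singleton (hE : IsDivisible R E)
    (p : F →ₗ.[R] E) {x : F} (hx : (p.domain.colon {x}).IsPrincipal) :
    ∃ q : F →ₗ.[R] E, p ≤ q ∧ q.domain = p.domain ⊔ R ∙ x := by
  obtain ⟨a, ha⟩ := hx
  have hcolon (r : R) : r • x ∈ p.domain ↔ a ∣ r := by
    rw [← Submodule.mem_colon_singleton, ha, Ideal.submodule_span_eq, Ideal.mem_span_singleton]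
  have hax : a • x ∈ p.domain := (hcolon a).2 dvd_rfl
  obtain ⟨y, hy⟩ : ∃ y : E, a • y = p ⟨a • x, hax⟩ := by
    rcases eq_or_ne a 0 with rfl | ha0
    · exact ⟨0, (smul_zero _).trans <| p.map_zero.symm.trans <|
        congrArg p (Subtype.ext (zero_smul R x).symm)⟩
    · exact hE a ha0 _
  refine exists_le_domain_eq_sup_span_singleton p (y := y) fun r hr => ?_
  obtain ⟨k, rfl⟩ := (hcolon r).1 hr
  calc p ⟨(a * k) • x, hr⟩ = p (k • ⟨a • x, hax⟩) :=
        congrArg p (Subtype.ext (by simp [mul_smul, mul_comm a k]))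
    _ = (a * k) • y := by rw [p.map_smul, ← hy, smul_smul, mul_comm]

theorem IsDivisible.exists_extend_sup_span_range [IsDomain R] [IsBezout R]
    [Module.IsTorsionFree R F] (hE : IsDivisible R E) (p : F →ₗ.[R] E)
    (hp : Module.Projective R p.domain) (f : ℕ → F) :
    ∃ q : F →ₗ.[R] E, p ≤ q ∧ q.domain = p.domain ⊔ Submodule.span R (Set.range f) :=
  exists_le_domain_eq_sup_span_range (P := fun N => Module.Projective R N)
    (fun N x _ => projective_sup_span_singleton N x)
    (fun q x _ => hE.exists_extend_sup_span_singleton q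
      (isPrincipal_colon_singleton q.domain x)) p hp f

end DivisibleExtension

section Saturation

variable {R F Y : Type*} [Ring R] [AddCommGroup F] [Module R F] {H : Submodule R F}

/-- For an embedding `e` of `H ≤ F` into the free module `Y →₀ R`, the coordinates at which `e h` is
nonzero for some `h ∈ H ∩ W`. -/
def activeCoords (e : H →ₗ[R] Y →₀ R) (W : Submodule R F) : Set Y :=
  {j | ∃ h : H, (h : F) ∈ W ∧ e h j ≠ 0}

/-- If `π` is a retraction of the embedding `e` of `H` into `Y →₀ R`, the submodule `W` is saturated
when it contains the image under `π` of every coordinate vector active in `H ∩ W`. This makes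
`H ∩ W` a direct summand of `H`, in a form that is preserved by directed unions. -/
def IsSaturated (e : H →ₗ[R] Y →₀ R) (π : (Y →₀ R) →ₗ[R] H) (W : Submodule R F) : Prop :=
  ∀ j ∈ activeCoords e W, (π (Finsupp.single j 1) : F) ∈ W

theorem isSaturated_bot {e : H →ₗ[R] Y →₀ R} {π : (Y →₀ R) →ₗ[R] H} : IsSaturated e π ⊥ := by
  rintro j ⟨h, hh, hj⟩
  rw [Submodule.mem_bot, ZeroMemClass.coe_eq_zero] at hh
  exact absurd (by rw [hh, map_zero, Finsupp.zero_apply]) hj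

theorem IsSaturated.projective_sup {e : H →ₗ[R] Y →₀ R} {π : (Y →₀ R) →ₗ[R] H}
    (hπ : Function.LeftInverse π e) {W : Submodule R F} (hW : IsSaturated e π W)
    [Module.Projective R W] : Module.Projective R (H ⊔ W : Submodule R F) := by
  classical
  have : Module.Projective R H := .of_split e π (LinearMap.ext hπ)
  set T := activeCoords e W
  let proj : (Y →₀ R) →ₗ[R] Finsupp.supported R R T := Finsupp.restrictDom R R T
  refine projective_sup_of_retraction (π ∘ₗ (Finsupp.supported R R T).subtype ∘ₗ proj ∘ₗ e)
    (fun h => ?_) fun h hh => ?_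
  · have hle : Finsupp.supported R R T ≤ W.comap (H.subtype ∘ₗ π) := by
      rw [Finsupp.supported_eq_span_single, Submodule.span_le]
      rintro _ ⟨j, hj, rfl⟩
      exact hW j hj
    exact hle (proj (e h)).2
  · have he : e h ∈ Finsupp.supported R R T := fun j hj =>
      ⟨h, hh, Finsupp.mem_support_iff.1 hj⟩
    have hproj : proj (e h) = ⟨e h, he⟩ :=
      LinearMap.congr_fun (Finsupp.restrictDom_comp_subtype (M := R) (R := R) T) ⟨e h, he⟩
    simp only [LinearMap.comp_apply, hproj, Submodule.subtype_apply, hπ h]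

end Saturation

section FiniteActiveCoords

variable {R F Y : Type*} [CommRing R] [IsDomain R] [AddCommGroup F] [Module R F]
  {H : Submodule R F} (e : H →ₗ[R] Y →₀ R) (W : Submodule R F)

/-- For a fixed `h₀ ∈ H ∩ (W ⊔ R ∙ x)` outside `W`, every element of `H ∩ (W ⊔ R ∙ x)` has a nonzero
multiple in `R ∙ h₀` modulo `H ∩ W`, so the new active coordinates lie in the support of `e h₀`. -/
theorem finite_activeCoords_sup_span_singleton_sdiff (x : F) :
    (activeCoords e (W ⊔ R ∙ x) \ activeCoords e W).Finite := by
  by_cases hle : ∀ h : H, (h : F) ∈ W ⊔ R ∙ x → (h : F) ∈ W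
  · convert Set.finite_empty (α := Y)
    exact Set.sdiff_eq_empty.2 fun j ⟨h, hh, hj⟩ => ⟨h, hle h hh, hj⟩
  push Not at hle
  simp only [Submodule.mem_sup, Submodule.mem_span_singleton, exists_exists_eq_and] at hle
  obtain ⟨h₀, ⟨w₀, hw₀, c, hh₀⟩, h₀W⟩ := hle
  have hc : c ≠ 0 := by
    rintro rfl
    exact h₀W (by rwa [← hh₀, zero_smul, add_zero])
  refine (e h₀).support.finite_toSet.subset ?_
  rintro j ⟨⟨h, hh, hj⟩, hjW⟩
  simp only [Submodule.mem_sup, Submodule.mem_span_singleton, exists_exists_eq_and] at hh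
  obtain ⟨w, hw, d, hh⟩ := hh
  by_contra hj₀
  have hj₀ : e h₀ j = 0 := by simpa using hj₀
  have hcomb : ((c • h - d • h₀ : H) : F) = c • w - d • w₀ := by
    rw [Submodule.coe_sub, Submodule.coe_smul, Submodule.coe_smul, ← hh, ← hh₀]
    module
  refine hjW ⟨c • h - d • h₀, ?_, ?_⟩
  · exact hcomb ▸ W.sub_mem (W.smul_mem _ hw) (W.smul_mem _ hw₀)
  · simp [hj₀, hc, hj]

theorem finite_activeCoords_sup_span_sdiff {A : Set F} (hA : A.Finite) :
    (activeCoords e (W ⊔ Submodule.span R A) \ activeCoords e W).Finite := by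
  induction A, hA using Set.Finite.induction_on with
  | empty => simp
  | @insert x A _ _ ih =>
    have hx := finite_activeCoords_sup_span_singleton_sdiff e (W ⊔ Submodule.span R A) x
    rw [sup_assoc, sup_comm (Submodule.span R A), ← Submodule.span_insert] at hx
    exact (hx.union ih).subset (sdiff_triangle ..)

end FiniteActiveCoords

theorem exists_countable_superset_closed {X : Type*} {c : Set X → Set X}
    (hc : ∀ A, A.Finite → (c A).Countable) {Z₀ : Set X} (hZ₀ : Z₀.Countable) :
    ∃ Z ⊇ Z₀, Z.Countable ∧ ∀ A ⊆ Z, A.Finite → c A ⊆ Z := by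
  let next (Z : Set X) : Set X := Z ∪ ⋃ A ∈ {A | A.Finite ∧ A ⊆ Z}, c A
  let Z (n : ℕ) : Set X := next^[n] Z₀
  have hsucc (n : ℕ) : Z (n + 1) = next (Z n) := Function.iterate_succ_apply' next n Z₀
  have hmono : Monotone Z := monotone_nat_of_le_succ fun n => hsucc n ▸ Set.subset_union_left
  have hcount (n : ℕ) : (Z n).Countable := by
    induction n with
    | zero => exact hZ₀
    | succ n ih =>
      rw [hsucc]
      exact ih.union ((Set.countable_ofPred_finite_subset ih).biUnion fun A hA => hc A hA.1)
  refine ⟨⋃ n, Z n, Set.subset_iUnion Z 0, Set.countable_iUnion hcount, fun A hA hfin => ?_⟩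
  obtain ⟨_, ⟨n, rfl⟩, hn⟩ :=
    DirectedOn.exists_mem_subset_of_finite_of_subset_sUnion (Set.range_nonempty Z)
      (directedOn_range.2 hmono.directed_le) hfin hA
  refine Set.Subset.trans ?_ (Set.subset_iUnion Z (n + 1))
  rw [hsucc]
  exact Set.subset_union_of_subset_right
    (Set.subset_biUnion_of_mem (s := {A | A.Finite ∧ A ⊆ Z n}) (u := c) ⟨hfin, hn⟩) _

theorem isSaturated_supported_sUnion {R X Y : Type*} [Ring R] {H : Submodule R (X →₀ R)}
    {e : H →ₗ[R] Y →₀ R} {π : (Y →₀ R) →ₗ[R] H} {c : Set (Set X)} (hne : c.Nonempty)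
    (hdir : DirectedOn (· ⊆ ·) c) (hc : ∀ S ∈ c, IsSaturated e π (Finsupp.supported R R S)) :
    IsSaturated e π (Finsupp.supported R R (⋃₀ c)) := by
  rintro j ⟨h, hh, hj⟩
  obtain ⟨S, hS, hn⟩ := hdir.exists_mem_subset_of_finite_of_subset_sUnion hne
    (h : X →₀ R).support.finite_toSet hh
  exact Finsupp.supported_mono (Set.subset_sUnion_of_mem hS) (hc S hS j ⟨h, hn, hj⟩)

theorem exists_countable_isSaturated_supported_union {R X Y : Type*} [CommRing R] [IsDomain R]
    {H : Submodule R (X →₀ R)} {e : H →ₗ[R] Y →₀ R} {π : (Y →₀ R) →ₗ[R] H} {S : Set X}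
    (hS : IsSaturated e π (Finsupp.supported R R S)) {Z₀ : Set X} (hZ₀ : Z₀.Countable) :
    ∃ Z ⊇ Z₀, Z.Countable ∧ IsSaturated e π (Finsupp.supported R R (S ∪ Z)) := by
  let newCoords (A : Set X) : Set Y := activeCoords e (Finsupp.supported R R (S ∪ A)) \
    activeCoords e (Finsupp.supported R R S)
  let c (A : Set X) : Set X := ⋃ j ∈ newCoords A, (π (Finsupp.single j 1) : X →₀ R).support
  have hc (A : Set X) (hA : A.Finite) : (c A).Countable := by
    have hfin : (newCoords A).Finite := by
      have := finite_activeCoords_sup_span_sdiff e (Finsupp.supported R R S)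
        (hA.image fun i => Finsupp.single i 1)
      rwa [← Finsupp.supported_eq_span_single, ← Finsupp.supported_union] at this
    exact hfin.countable.biUnion fun j _ => Finset.countable_toSet _
  obtain ⟨Z, hZ, hcount, hclosed⟩ := exists_countable_superset_closed hc hZ₀
  refine ⟨Z, hZ, hcount, ?_⟩
  rintro j ⟨h, hh, hj⟩
  by_cases hjS : j ∈ activeCoords e (Finsupp.supported R R S)
  · exact Finsupp.supported_mono Set.subset_union_left (hS j hjS)
  set A : Set X := (h : X →₀ R).support ∩ Z
  have hA : (h : X →₀ R) ∈ Finsupp.supported R R (S ∪ A) := fun i hi =>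
    (hh hi).imp_right fun hiZ => ⟨hi, hiZ⟩
  have hAZ : c A ⊆ Z :=
    hclosed A Set.inter_subset_right ((Finset.finite_toSet _).inter_of_left Z)
  have hjA : j ∈ newCoords A := ⟨⟨h, hA, hj⟩, hjS⟩
  exact fun i hi => Or.inr (hAZ (Set.mem_biUnion hjA hi))

section SaturatedExtension

variable {R E X Y : Type*} [Ring R] [AddCommGroup E] [Module R E] {H : Submodule R (X →₀ R)}

/-- The poset to which Zorn's lemma is applied: the extensions of `f : H → E` to a partial map on
`X →₀ R` with domain `H ⊔ Finsupp.supported R R S`, for a saturated set `S` of coordinates. -/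
def saturatedExtensions (e : H →ₗ[R] Y →₀ R) (π : (Y →₀ R) →ₗ[R] H) (f : H →ₗ[R] E) :
    Set (Set X × ((X →₀ R) →ₗ.[R] E)) :=
  {q | IsSaturated e π (Finsupp.supported R R q.1) ∧ ⟨H, f⟩ ≤ q.2 ∧
    q.2.domain = H ⊔ Finsupp.supported R R q.1}

variable {e : H →ₗ[R] Y →₀ R} {π : (Y →₀ R) →ₗ[R] H} {f : H →ₗ[R] E}

theorem empty_mem_saturatedExtensions : (∅, ⟨H, f⟩) ∈ saturatedExtensions e π f :=
  by
  refine ⟨?_, le_rfl, by simp⟩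
  rw [Finsupp.supported_empty]
  exact isSaturated_bot

theorem exists_upperBound_mem_saturatedExtensions {c : Set (Set X × ((X →₀ R) →ₗ.[R] E))}
    (hc : c ⊆ saturatedExtensions e π f) (hchain : IsChain (· ≤ ·) c) (hne : c.Nonempty) :
    ∃ q ∈ saturatedExtensions e π f, q ∈ upperBounds c := by
  obtain ⟨q₀, hq₀⟩ := hne
  have hdir : DirectedOn (· ≤ ·) c := hchain.directedOn
  have hdirS : DirectedOn (· ⊆ ·) (Prod.fst '' c) :=
    directedOn_image.2 (hdir.mono fun _ _ h => h.1)
  have hdirp : DirectedOn (· ≤ ·) (Prod.snd '' c) :=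
    directedOn_image.2 (hdir.mono fun _ _ h => h.2)
  have hle (q) (hq : q ∈ c) : q ≤ (⋃₀ (Prod.fst '' c), LinearPMap.sSup _ hdirp) :=
    ⟨Set.subset_sUnion_of_mem ⟨q, hq, rfl⟩, LinearPMap.le_sSup hdirp ⟨q, hq, rfl⟩⟩
  have hsat : IsSaturated e π (Finsupp.supported R R (⋃₀ (Prod.fst '' c))) :=
    isSaturated_supported_sUnion ⟨_, q₀, hq₀, rfl⟩ hdirS <|
      Set.forall_mem_image.2 fun q hq => (hc hq).1
  have hext : ⟨H, f⟩ ≤ LinearPMap.sSup _ hdirp := (hc hq₀).2.1.trans (hle q₀ hq₀).2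
  refine ⟨_, ⟨hsat, hext, le_antisymm ?_ (sup_le hext.1 ?_)⟩, hle⟩
  · rw [LinearPMap.domain_sSup]
    refine sSup_le ?_
    rintro _ ⟨_, ⟨q, hq, rfl⟩, rfl⟩
    rw [(hc hq).2.2]
    exact sup_le_sup_left (Finsupp.supported_mono (hle q hq).1) H
  · rw [Set.sUnion_image, Set.biUnion_eq_iUnion, Finsupp.supported_iUnion]
    exact iSup_le fun ⟨q, hq⟩ => le_trans ((hc hq).2.2 ▸ le_sup_right) (hle q hq).2.1

end SaturatedExtension

section ExtensionToFree

variable {R E : Type u} [CommRing R] [IsDomain R] [IsBezout R] [AddCommGroup E] [Module R E]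
  {X : Type*} {H : Submodule R (X →₀ R)}

theorem IsDivisible.exists_le_mem_saturatedExtensions {Y : Type*} {e : H →ₗ[R] Y →₀ R}
    {π : (Y →₀ R) →ₗ[R] H} (hE : IsDivisible R E) (hπ : Function.LeftInverse π e) {f : H →ₗ[R] E}
    {q : Set X × ((X →₀ R) →ₗ.[R] E)} (hq : q ∈ saturatedExtensions e π f) (x : X) :
    ∃ q' ∈ saturatedExtensions e π f, q ≤ q' ∧ x ∈ q'.1 := by
  obtain ⟨S, p⟩ := q
  obtain ⟨hS, hfp, hp⟩ := hq
  obtain ⟨Z, hxZ, hcount, hZ⟩ :=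
    exists_countable_isSaturated_supported_union hS (Set.countable_singleton x)
  obtain ⟨z, rfl⟩ := hcount.exists_eq_range ⟨x, hxZ rfl⟩
  have : Module.Projective R (Finsupp.supported R R S) :=
    .of_equiv (Finsupp.supportedEquivFinsupp S).symm
  obtain ⟨p', hpp', hp'⟩ := hE.exists_extend_sup_span_range p (hp ▸ hS.projective_sup hπ)
    fun n => Finsupp.single (z n) 1
  have hdom : p'.domain = H ⊔ Finsupp.supported R R (S ∪ Set.range z) := by
    rw [hp', hp, Finsupp.supported_union, Finsupp.supported_eq_span_single R (Set.range z),
      sup_assoc, ← Set.range_comp]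
    rfl
  exact ⟨(S ∪ Set.range z, p'), ⟨hZ, hfp.trans hpp', hdom⟩,
    ⟨Set.subset_union_left, hpp'⟩, Or.inr (hxZ rfl)⟩

theorem IsDivisible.exists_extend [Module.Projective R H] (hE : IsDivisible R E) (f : H →ₗ[R] E) :
    ∃ g : (X →₀ R) →ₗ[R] E, ∀ h : H, g h = f h := by
  obtain ⟨e, he⟩ := Module.projective_def.1 ‹Module.Projective R H›
  obtain ⟨⟨S, p⟩, -, hq, hmax⟩ := zorn_le_nonempty₀ (saturatedExtensions e _ f)
    (fun c hc hchain q hq => exists_upperBound_mem_saturatedExtensions hc hchain ⟨q, hq⟩) _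
    empty_mem_saturatedExtensions
  have hS : S = Set.univ := Set.eq_univ_of_forall fun x => by
    obtain ⟨q', hq', hle, hx⟩ := hE.exists_le_mem_saturatedExtensions he hq x
    exact (hmax hq' hle).1 hx
  have htop : p.domain = ⊤ := by rw [hq.2.2, hS, Finsupp.supported_univ, sup_top_eq]
  refine ⟨p.toFun ∘ₗ LinearMap.codRestrict p.domain LinearMap.id (by simp [htop]), fun h => ?_⟩
  exact (hq.2.1.2 (x := h) rfl).symm

end ExtensionToFree

open CategoryTheory

section Ext

universe w v

variable {C : Type v} [Category.{w} C] [Abelian C] [HasExt.{w} C] {S : ShortComplex C}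

theorem subsingleton_ext_one_of_forall_extend (hS : S.ShortExact) [Projective S.X₂] {Y : C}
    (h : ∀ f : S.X₁ ⟶ Y, ∃ g : S.X₂ ⟶ Y, S.f ≫ g = f) :
    Subsingleton (Abelian.Ext S.X₃ Y 1) := by
  refine subsingleton_of_forall_eq 0 fun x => ?_
  obtain ⟨y, rfl⟩ := Abelian.Ext.contravariant_sequence_exact₃ hS Y x
    (Abelian.Ext.eq_zero_of_projective _) (add_zero 1)
  obtain ⟨f, rfl⟩ := (Abelian.Ext.mk₀_bijective _ _).2 y
  obtain ⟨g, rfl⟩ := h f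
  rw [← Abelian.Ext.mk₀_comp_mk₀, ShortComplex.ShortExact.extClass_comp_assoc]

theorem exists_extend_of_subsingleton_ext_one (hS : S.ShortExact) {Y : C}
    [Subsingleton (Abelian.Ext S.X₃ Y 1)] (f : S.X₁ ⟶ Y) : ∃ g : S.X₂ ⟶ Y, S.f ≫ g = f := by
  obtain ⟨y, hy⟩ := Abelian.Ext.contravariant_sequence_exact₁ hS Y (Abelian.Ext.mk₀ f)
    (add_zero 1) (Subsingleton.elim _ _)
  obtain ⟨g, rfl⟩ := (Abelian.Ext.mk₀_bijective _ _).2 y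
  refine ⟨g, (Abelian.Ext.mk₀_bijective _ _).1 ?_⟩
  rwa [← Abelian.Ext.mk₀_comp_mk₀]

end Ext

section Objects

variable {V : Type u} [CommRing V]

theorem isObject_iff_projective_ker {F C : Type u} [AddCommGroup F] [Module V F]
    [AddCommGroup C] [Module V C] [Module.Projective V F] {q : F →ₗ[V] C}
    (hq : Function.Surjective q) : IsObject V C ↔ Module.Projective V (LinearMap.ker q) := by
  have hF : Projective (ModuleCat.of V F) := (IsProjective.iff_projective F).1 inferInstance
  rw [IsProjective.iff_projective, projective_iff_hasProjectiveDimensionLT_one]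
  exact (LinearMap.shortExact_shortComplexKer hq).hasProjectiveDimensionLT_X₃_iff 0 hF

theorem isObject_of_projective (P : Type u) [AddCommGroup P] [Module V P]
    [Module.Projective V P] : IsObject V P := by
  refine (isObject_iff_projective_ker (q := LinearMap.id) Function.surjective_id).2 ?_
  rw [LinearMap.ker_id]
  infer_instance

theorem exists_extend_of_subsingleton_ext_quotient {B E : Type u} [AddCommGroup B] [Module V B]
    [AddCommGroup E] [Module V E] (A : Submodule V B)
    [Subsingleton (Abelian.Ext.{u} (ModuleCat.of V (B ⧸ A)) (ModuleCat.of V E) 1)]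
    (φ : A →ₗ[V] E) : ∃ ψ : B →ₗ[V] E, ∀ a : A, ψ (a : B) = φ a := by
  let S : ShortComplex (ModuleCat.{u} V) :=
    ShortComplex.mk (ModuleCat.ofHom A.subtype) (ModuleCat.ofHom A.mkQ) (by ext; simp)
  have hS : S.ShortExact := ModuleCat.shortComplex_shortExact S
    (LinearMap.exact_subtype_mkQ A) A.injective_subtype A.mkQ_surjective
  have : Subsingleton (Abelian.Ext.{u} S.X₃ (ModuleCat.of V E) 1) := ‹_›
  obtain ⟨g, hg⟩ := exists_extend_of_subsingleton_ext_one hS (ModuleCat.ofHom φ)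
  exact ⟨g.hom, fun a => LinearMap.congr_fun (congrArg ModuleCat.Hom.hom hg) a⟩

variable [IsDomain V]

theorem isObject_quotient_span_singleton (r : V) : IsObject V (V ⧸ V ∙ r) := by
  refine (isObject_iff_projective_ker (V ∙ r).mkQ_surjective).2 ?_
  rw [Submodule.ker_mkQ]
  exact projective_span_singleton r

variable [IsBezout V] {E : Type u} [AddCommGroup E] [Module V E]

theorem IsObject.isTight_span_singleton (hE : IsObject V E) (y : E) : IsTight (V ∙ y) := by
  refine ⟨hE, ?_⟩
  set q : (E →₀ V) →ₗ[V] E := Finsupp.linearCombination V id with hq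
  have hsurj : Function.Surjective q := Finsupp.linearCombination_id_surjective V E
  have := (isObject_iff_projective_ker hsurj).1 hE
  refine (isObject_iff_projective_ker (q := (V ∙ y).mkQ ∘ₗ q)
    ((V ∙ y).mkQ_surjective.comp hsurj)).2 ?_
  have hmap : V ∙ y = (V ∙ (Finsupp.single y 1 : E →₀ V)).map q := by
    rw [Submodule.map_span, Set.image_singleton, hq, Finsupp.linearCombination_single, one_smul,
      id]
  rw [LinearMap.ker_comp, Submodule.ker_mkQ, hmap, Submodule.comap_map_eq, sup_comm]
  exact projective_sup_span_singleton _ _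

theorem isDivisible_of_forall_extend (hE : IsObject V E)
    (h : ∀ (B : Type u) [AddCommGroup B] [Module V B] (A : Submodule V B),
      IsObject V B → IsObject V A → IsTight A → ∀ φ : A →ₗ[V] E, IsMorphism φ →
        ∃ ψ : B →ₗ[V] E, ∀ a : A, ψ (a : B) = φ a) : IsDivisible V E := by
  intro r hr y
  let ε := LinearEquiv.toSpanNonzeroSingleton V V r hr
  let φ : (V ∙ r) →ₗ[V] E := LinearMap.toSpanSingleton V E y ∘ₗ ε.symm.toLinearMap
  have hε : (ε 1 : V) = r := by simp [ε]
  have hφε : φ (ε 1) = y := by simp [φ]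
  have hV : IsObject V V := isObject_of_projective V
  have := projective_span_singleton (R := V) r
  have hA : IsObject V (V ∙ r) := isObject_of_projective _
  have hφ : LinearMap.range φ = V ∙ y := by
    rw [LinearMap.range_comp_of_range_eq_top _ ε.symm.range, LinearMap.range_toSpanSingleton]
  obtain ⟨ψ, hψ⟩ := h V (V ∙ r) hV hA ⟨hV, isObject_quotient_span_singleton r⟩ φ
    ⟨hA, hE, hφ ▸ hE.isTight_span_singleton y⟩
  refine ⟨ψ 1, ?_⟩
  calc r • ψ 1 = ψ (ε 1 : V) := by rw [← map_smul, smul_eq_mul, mul_one, hε]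
    _ = y := by rw [hψ, hφε]

theorem IsDivisible.subsingleton_ext_one {C : Type u} [AddCommGroup C] [Module V C]
    (hE : IsDivisible V E) (hC : IsObject V C) :
    Subsingleton (Abelian.Ext.{u} (ModuleCat.of V C) (ModuleCat.of V E) 1) := by
  set q : (C →₀ V) →ₗ[V] C := Finsupp.linearCombination V id
  have hq : Function.Surjective q := Finsupp.linearCombination_id_surjective V C
  have := (isObject_iff_projective_ker hq).1 hC
  have : Projective q.shortComplexKer.X₂ :=
    (IsProjective.iff_projective (R := V) (C →₀ V)).1 inferInstance
  refine subsingleton_ext_one_of_forall_extend (LinearMap.shortExact_shortComplexKer hq) fun f => ?_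
  obtain ⟨g, hg⟩ := hE.exists_extend (H := LinearMap.ker q) f.hom
  exact ⟨ModuleCat.ofHom g, ModuleCat.hom_ext (LinearMap.ext hg)⟩

end Objects

end TightModules

theorem mainTheorem1_general {V : Type u} [CommRing V] [IsDomain V] [IsBezout V]
    (E : Type u) [AddCommGroup E] [Module V E] (hE : TightModules.IsObject V E) :
    List.TFAE [
      ∀ (C : Type u) [AddCommGroup C] [Module V C], TightModules.IsObject V C →
        Subsingleton (CategoryTheory.Abelian.Ext.{u} (ModuleCat.of V C) (ModuleCat.of V E) 1),
      ∀ (B : Type u) [AddCommGroup B] [Module V B] (A : Submodule V B),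
        TightModules.IsObject V B → TightModules.IsObject V A → TightModules.IsTight A →
        ∀ φ : A →ₗ[V] E, TightModules.IsMorphism φ →
          ∃ ψ : B →ₗ[V] E, ∀ a : A, ψ (a : B) = φ a,
      TightModules.IsDivisible V E] := by
  tfae_have 1 → 2 := fun h B _ _ A _ _ hA φ _ =>
    have := h (B ⧸ A) hA.quotient
    TightModules.exists_extend_of_subsingleton_ext_quotient A φ
  tfae_have 2 → 3 := TightModules.isDivisible_of_forall_extend hE
  tfae_have 3 → 1 := fun h C _ _ hC => h.subsingleton_ext_one hC
  tfae_finish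

theorem mainTheorem1 {V : Type u} [CommRing V] [IsDomain V] [ValuationRing V]
    (E : Type u) [AddCommGroup E] [Module V E] (hE : TightModules.IsObject V E) :
    List.TFAE [
      ∀ (C : Type u) [AddCommGroup C] [Module V C], TightModules.IsObject V C →
        Subsingleton (CategoryTheory.Abelian.Ext.{u} (ModuleCat.of V C) (ModuleCat.of V E) 1),
      ∀ (B : Type u) [AddCommGroup B] [Module V B] (A : Submodule V B),
        TightModules.IsObject V B → TightModules.IsObject V A → TightModules.IsTight A →
        ∀ φ : A →ₗ[V] E, TightModules.IsMorphism φ →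
          ∃ ψ : B →ₗ[V] E, ∀ a : A, ψ (a : B) = φ a,
      TightModules.IsDivisible V E] :=
  mainTheorem1_general E hE
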